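/- **Conventions.** A left brace is a set $B$ with an abelian group structure $+$ and a group structure $\circ$ such that $a\circ(b+c)+a=a\circ b+a\circ c$ for all $a,b,c$; put $\lambda_a(b)=-a+a\circ b$. It is trivial if $\circ=+$. A solution $(X,r)$ (involutive, non-degenerate, set-theoretic solution of the Yang–Baxter equation) is a map $r(x,y)=(\sigma_x(y),\gamma_y(x))$ on $X^2$ with $r^2=\mathrm{id}$, all $\sigma_x,\gamma_y$ bijective and $r_{12}r_{23}r_{12}=r_{23}r_{12}r_{23}$. Its structure group is $G(X,r)=\langle x\in X\mid xy=\sigma_x(y)\gamma_y(x)\rangle$, with its natural left brace structure, in which $\lambda_x(y)=\sigma_x(y)$ for $x,y\in X$; its permutation group $\mathcal G(X,r)=\langle\sigma_x\mid x\in X\rangle\le \mathrm{Sym}_X$ carries the unique left brace structure for which $x\mapsto\sigma_x$ extends to a homomorphism of left braces $G(X,r)\to\mathcal G(X,r)$. If $H$ is an abelian group (a trivial brace), $S$ a left brace, $\alpha\colon(S,\circ)\to\mathrm{Aut}(H)$ a homomorphism and $b\colon H\times H\to (S,+)$ a symmetric bilinear map with $\lambda_s(b(f,h))=b(\alpha_s(f),\alpha_s(h))$,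 the asymmetric product $H\rtimes_\circ S$ is the left brace on $H\times S$ with $(f,s)\circ(h,u)=(f+\alpha_s(h),s\circ u)$ and $(f,s)+(h,u)=(f+h,s+u+b(f,h))$. **Setting.** Let $A$ be an abelian group, $t\in\mathrm{Aut}(A)$ with $t-\mathrm{id}$ invertible, $T=\langle t\rangle\le\mathrm{Aut}(A)$, and let $(j_a)_{a\in A}$ be a family of elements of $A$ with $j_{-a}=j_a$ and $j_{t^z(a)}=t^z(j_a)-(t^z-\mathrm{id})(j_0)$ for all $a\in A$, $z\in\mathbb Z$. Let $A_1=A\rtimes T$ be the semidirect product of the trivial braces on $A$ and $T$, that is, $(a,\tau)+(c,\upsilon)=(a+c,\tau\upsilon)$ and $(a,\tau)\circ(c,\upsilon)=(a+\tau(c),\tau\upsilon)$. Let $(A^2,r)$ be the solution with $\sigma_{(a_1,a_2)}(c_1,c_2)=(t(c_1)+a_2,\;t(c_2-j_{t(c_1)+a_2-a_1}))$. Suppose that $A$ has finite exponent $n$. Let $H'$ be the group of finitely supported functions $A\to\mathbb Z/(n)$, and define $\alpha'\colon A_1\to\mathrm{Aut}(H')$ and $b'\colon H'\times H'\to A_1$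 by $$\alpha'(a,t^z)(f)=f\circ g_{(a,t^z)},\qquad g_{(a,t^z)}(x)=t^{-z}\bigl(x-a-(t-\mathrm{id})^{-2}(t^{z+1}-t)(j_0)\bigr),$$ $$b'(f,h)=\Bigl(\sum_{x,y\in A}f(x)h(y)\,t(j_{x-y}-j_0),\ \mathrm{id}\Bigr).$$ Let $B'=H'\rtimes_\circ A_1$ be the asymmetric product via $\alpha'$ and $b'$. Let $e'_a\in H'$ be the indicator function of $\{a\}$, put $x'_{(a,c)}=(e'_a,(c-t(t-\mathrm{id})^{-1}(j_0),t))\in B'$ and $X'=\{x'_{(a,c)}\mid a,c\in A\}$, and let $r'$ be the restriction to $(X')^2$ of the solution $(u,v)\mapsto(\lambda_u(v),\lambda_{\lambda_u(v)}^{-1}(u))$ associated to $B'$. **Theorem 4.5.** Suppose that $n>1$ and that the order of $t$ is finite and coprime to $n$. Let $H_1=\{f\in H'\mid b'(f,h)=(0,\mathrm{id})\text{ for all }h\in H'\}$, a subgroup of $H'$. Then $\overline\alpha(s)(f+H_1)=\alpha'(s)(f)+H_1$ and $\overline b(f+H_1,h+H_1)=b'(f,h)$ are well defined on $H'/H_1$,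 and, as left braces, $$\mathcal G(X',r')\;\cong\; H'/H_1\rtimes_\circ A_1\;\cong\;\mathcal G(A^2,r),$$ where the middle term is the asymmetric product of the trivial brace $H'/H_1$ and the left brace $A_1$ via $\overline\alpha$ and $\overline b$. -/

import Mathlib

open Function

/-- A left brace: a set `B` with an abelian group structure `+` and a group structure `*` (written
`∘` in the literature) such that `a ∘ (b + c) + a = a ∘ b + a ∘ c`. Since Mathlib's `≃+*` means a
bijection preserving `+` and `*`, an isomorphism of left braces `B → C` is an element of `B ≃+* C`.
-/
class LeftBrace (B : Type*) extends AddCommGroup B, Group B where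
  brace_axiom : ∀ a b c : B, a * (b + c) + a = a * b + a * c

namespace LeftBrace

variable {B : Type*} [LeftBrace B]

theorem mul_zero' (a : B) : a * 0 = a := by
  have h := brace_axiom a 0 0
  rw [add_zero] at h
  exact (add_left_cancel h).symm

theorem zero_eq_one : (0 : B) = 1 := by
  have h := mul_zero' (1 : B)
  rwa [one_mul] at h

theorem mul_add' (a b c : B) : a * (b + c) = a * b + a * c - a := by
  rw [← brace_axiom a b c, add_sub_cancel_right]

/-- The lambda map `λ_a(b) = -a + a ∘ b`. -/
def lam (a b : B) : B := -a + a * b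

theorem mul_eq (a b : B) : a * b = a + lam a b := by simp [lam]

theorem lam_add (a b c : B) : lam a (b + c) = lam a b + lam a c := by
  simp only [lam, mul_add']; abel

theorem lam_one (b : B) : lam 1 b = b := by
  rw [lam, one_mul, ← zero_eq_one, neg_zero, zero_add]

theorem lam_zero (a : B) : lam a 0 = 0 := by
  simp [lam, mul_zero']

theorem lam_mul (a b c : B) : lam (a * b) c = lam a (lam b c) := by
  have h : a * b + lam a (lam b c) = a * b * c := by
    have h1 : a * b * c = a * (b + lam b c) := by rw [← mul_eq, mul_assoc]
    rw [h1, mul_add', mul_eq a (lam b c)]; abel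
  rw [lam, ← h]; abel

/-- The permutation `λ_a` of a left brace, with inverse `λ_{a⁻¹}`. -/
def lamPerm (a : B) : Equiv.Perm B where
  toFun := lam a
  invFun := lam a⁻¹
  left_inv b := by rw [← lam_mul, inv_mul_cancel, lam_one]
  right_inv b := by rw [← lam_mul, mul_inv_cancel, lam_one]

end LeftBrace

/-- The map `r × id` on `X³`. -/
def r12 {X : Type*} (r : X × X → X × X) (p : X × X × X) : X × X × X :=
  ((r (p.1, p.2.1)).1, (r (p.1, p.2.1)).2, p.2.2)

/-- The map `id × r` on `X³`. -/
def r23 {X : Type*} (r : X × X → X × X) (p : X × X × X) : X × X × X :=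
  (p.1, r p.2)

/-- An involutive, non-degenerate set-theoretic solution `(X, r)` of the Yang--Baxter equation:
`r² = id`, with `r (x, y) = (σ_x y, γ_y x)` all `σ_x` and all `γ_y` are bijective, and
`r₁₂ r₂₃ r₁₂ = r₂₃ r₁₂ r₂₃`. -/
structure YBSolution (X : Type*) where
  r : X × X → X × X
  invol : ∀ p, r (r p) = p
  left_bij : ∀ x, Bijective fun y => (r (x, y)).1
  right_bij : ∀ y, Bijective fun x => (r (x, y)).2
  braid : ∀ p, r12 r (r23 r (r12 r p)) = r23 r (r12 r (r23 r p))

namespace YBSolution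

section Basic

variable {X : Type*} (S : YBSolution X)

/-- The permutation `σ_x`, where `r (x, y) = (σ_x y, γ_y x)`. -/
noncomputable def sigma (x : X) : Equiv.Perm X := Equiv.ofBijective _ (S.left_bij x)

/-- The permutation `γ_y`, where `r (x, y) = (σ_x y, γ_y x)`. -/
noncomputable def gam (y : X) : Equiv.Perm X := Equiv.ofBijective _ (S.right_bij y)

theorem r_eq (x y : X) : S.r (x, y) = (S.sigma x y, S.gam y x) := rfl

theorem sigma_gam (x y : X) : S.sigma (S.sigma x y) (S.gam y x) = x :=
  congrArg Prod.fst (S.invol (x, y))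

theorem gam_gam (x y : X) : S.gam (S.gam y x) (S.sigma x y) = y :=
  congrArg Prod.snd (S.invol (x, y))

theorem sigma_mul (x y : X) :
    S.sigma x * S.sigma y = S.sigma (S.sigma x y) * S.sigma (S.gam y x) := by
  ext z
  exact (congrArg Prod.fst (S.braid (x, y, z))).symm

theorem gam_eq (x y : X) : S.gam y x = (S.sigma (S.sigma x y))⁻¹ x := by
  rw [Equiv.Perm.eq_inv_iff_eq, sigma_gam]

theorem diag_bij : Bijective fun x => (S.sigma x)⁻¹ x := by
  have key : ∀ x u, (S.sigma x)⁻¹ x = u ↔ S.gam u x = u := by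
    intro x u
    constructor
    · rintro rfl
      rw [gam_eq]; simp
    · intro h
      have h2 := S.gam_gam x u
      rw [h] at h2
      have h3 := (S.gam u).injective (h2.trans h.symm)
      rw [Equiv.Perm.inv_eq_iff_eq, h3]
  constructor
  · intro x y h
    have h1 := (key x _).1 rfl
    have h2 := (key y _).1 h.symm
    exact (S.gam _).injective (h1.trans h2.symm)
  · intro u
    exact ⟨(S.gam u)⁻¹ u, (key _ _).2 (by simp)⟩

/-- The permutation `x ↦ σ_x⁻¹(x)`. -/
noncomputable def diag : Equiv.Perm X := Equiv.ofBijective _ S.diag_bij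

theorem diag_apply (x : X) : S.diag x = (S.sigma x)⁻¹ x := rfl

theorem sigma_diag (x : X) : S.sigma x (S.diag x) = x := by simp [diag_apply]

end Basic

/-- The solution `r (x, y) = (σ_x y, σ_{σ_x y}⁻¹ x)` attached to a family of permutations `σ_x` with
`σ_x σ_{σ_x⁻¹ y} = σ_y σ_{σ_y⁻¹ x}`, when moreover `x ↦ σ_x⁻¹ x` is bijective. -/
def ofSigma {X : Type*} (σ : X → Equiv.Perm X)
    (hσ : ∀ x y z, σ x (σ ((σ x)⁻¹ y) z) = σ y (σ ((σ y)⁻¹ x) z))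
    (hT : Bijective fun x => (σ x)⁻¹ x) : YBSolution X where
  r p := (σ p.1 p.2, (σ (σ p.1 p.2))⁻¹ p.1)
  invol p := by
    obtain ⟨x, y⟩ := p
    simp
  left_bij x := (σ x).bijective
  right_bij y := by
    have h : (fun x => (σ x)⁻¹ x) ∘ (fun x => (σ (σ x y))⁻¹ x) =
        ⇑(σ y)⁻¹ ∘ fun x => (σ x)⁻¹ x := by
      funext x
      simp only [comp_apply]
      rw [Equiv.Perm.eq_inv_iff_eq, ← (σ x).injective.eq_iff]
      have h1 := hσ x (σ x y) ((σ ((σ (σ x y))⁻¹ x))⁻¹ ((σ (σ x y))⁻¹ x))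
      simp only [Equiv.Perm.coe_inv, Equiv.symm_apply_apply, Equiv.apply_symm_apply] at h1 ⊢
      exact h1
    have h2 : Bijective ((fun x => (σ x)⁻¹ x) ∘ (fun x => (σ (σ x y))⁻¹ x)) := by
      rw [h]; exact ((σ y)⁻¹).bijective.comp hT
    exact (Bijective.of_comp_iff' hT _).1 h2
  braid := by
    have hc : ∀ x y z, σ (σ x y) (σ ((σ (σ x y))⁻¹ x) z) = σ x (σ y z) := by
      intro x y z
      have := hσ x (σ x y) z
      simp only [Equiv.Perm.coe_inv, Equiv.symm_apply_apply] at this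
      exact this.symm
    let r : X × X → X × X := fun p => (σ p.1 p.2, (σ (σ p.1 p.2))⁻¹ p.1)
    let J : X × X × X → X × X × X := fun p => (p.1, σ p.1 p.2.1, σ p.1 (σ p.2.1 p.2.2))
    have hJ : Injective J := by
      rintro ⟨x, y, z⟩ ⟨x', y', z'⟩ h
      simp only [J, Prod.mk.injEq] at h
      obtain ⟨rfl, h2, h3⟩ := h
      obtain rfl := (σ x).injective h2
      obtain rfl := (σ y).injective ((σ x).injective h3)
      rfl
    have h12 : ∀ p, J (r12 r p) = ((J p).2.1, (J p).1, (J p).2.2) := by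
      rintro ⟨x, y, z⟩
      have h := hc x y z
      simp only [Equiv.Perm.coe_inv] at h
      simp [J, r12, r, h]
    have h23 : ∀ p, J (r23 r p) = ((J p).1, (J p).2.2, (J p).2.1) := by
      rintro ⟨x, y, z⟩
      simp [J, r23, r]
    intro p
    apply hJ
    change J (r12 r (r23 r (r12 r p))) = J (r23 r (r12 r (r23 r p)))
    simp only [h12, h23]

end YBSolution

/-- The solution associated to a left brace `B`:
`r_B (a, b) = (λ_a b, λ_{λ_a b}⁻¹ a)`. -/
def LeftBrace.solution (B : Type*) [LeftBrace B] : YBSolution B :=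
  YBSolution.ofSigma LeftBrace.lamPerm
    (by
      intro x y z
      change LeftBrace.lam x (LeftBrace.lam (LeftBrace.lam x⁻¹ y) z) =
        LeftBrace.lam y (LeftBrace.lam (LeftBrace.lam y⁻¹ x) z)
      have h : ∀ a b : B, a * LeftBrace.lam a⁻¹ b = a + b := by
        intro a b
        rw [LeftBrace.mul_eq, ← LeftBrace.lam_mul, mul_inv_cancel, LeftBrace.lam_one]
      rw [← LeftBrace.lam_mul, ← LeftBrace.lam_mul, h, h, add_comm])
    (by
      have h : (fun x : B => (LeftBrace.lamPerm x)⁻¹ x) = fun x => -x⁻¹ := by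
        funext x
        change LeftBrace.lam x⁻¹ x = _
        rw [LeftBrace.lam, inv_mul_cancel, ← LeftBrace.zero_eq_one, add_zero]
      rw [h]
      exact (Equiv.neg B).bijective.comp (Equiv.inv B).bijective)

theorem LeftBrace.solution_r {B : Type*} [LeftBrace B] (a b : B) :
    (LeftBrace.solution B).r (a, b) =
      (LeftBrace.lam a b, LeftBrace.lam (LeftBrace.lam a b)⁻¹ a) := rfl


section

universe u v

/-- Auxiliary: a group `G` generated by elements `ι x` (`x ∈ X`), subject at least to the relations
`ι x * ι y = ι (σ_x y) * ι (γ_y x)`, together with an action of `G` on `X` in which `ι x` acts as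
`σ_x`. Both the structure group and the permutation group of `(X, r)` are of this form, and the
natural left brace structure is constructed on both at once. -/
structure YBSolution.Realization {X : Type u} (S : YBSolution X) (G : Type v) [Group G] where
  ι : X → G
  act : G →* Equiv.Perm X
  act_ι : ∀ x, act (ι x) = S.sigma x
  gen : Subgroup.closure (Set.range ι) = ⊤
  rel : ∀ x y, ι x * ι y = ι (S.sigma x y) * ι (S.gam y x)

namespace YBSolution.Realization

variable {X : Type u} {S : YBSolution X} {G : Type v} [Group G] (R : S.Realization G)

/-- The permutation `g ↦ g * ι (g⁻¹ y)` of `G`; it becomes the additive translation by `ι y`. -/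
noncomputable def shift (y : X) : Equiv.Perm G where
  toFun g := g * R.ι ((R.act g)⁻¹ y)
  invFun h := h * (R.ι (S.diag.symm ((R.act h)⁻¹ y)))⁻¹
  left_inv g := by
    have h : (R.act (g * R.ι ((R.act g)⁻¹ y)))⁻¹ y = S.diag ((R.act g)⁻¹ y) := by
      rw [map_mul, R.act_ι, mul_inv_rev, Equiv.Perm.mul_apply, S.diag_apply]
    simp only [h, Equiv.symm_apply_apply, mul_inv_cancel_right]
  right_inv h := by
    have e : (R.act (h * (R.ι (S.diag.symm ((R.act h)⁻¹ y)))⁻¹))⁻¹ y =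
        S.diag.symm ((R.act h)⁻¹ y) := by
      rw [map_mul, map_inv, R.act_ι, mul_inv_rev, inv_inv, Equiv.Perm.mul_apply]
      conv_lhs => rw [← S.diag.apply_symm_apply ((R.act h)⁻¹ y)]
      rw [Equiv.symm_apply_apply, sigma_diag]
    simp only [e, inv_mul_cancel_right]

theorem shift_apply (y : X) (g : G) : R.shift y g = g * R.ι ((R.act g)⁻¹ y) := rfl

theorem shift_comm (y z : X) : R.shift y * R.shift z = R.shift z * R.shift y := by
  ext g
  simp only [Equiv.Perm.mul_apply, shift_apply, map_mul, R.act_ι, mul_inv_rev]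
  set a := (R.act g)⁻¹ y
  set b := (R.act g)⁻¹ z
  have h := R.rel a ((S.sigma a)⁻¹ b)
  rw [S.gam_eq, show S.sigma a ((S.sigma a)⁻¹ b) = b by simp] at h
  rw [mul_assoc, mul_assoc, h]

/-- The group generated by the permutations `g ↦ g * ι (g⁻¹ y)`; it is abelian and regular. -/
def shifts : Subgroup (Equiv.Perm G) := Subgroup.closure (Set.range R.shift)

theorem shifts_comm {σ τ : Equiv.Perm G} (hσ : σ ∈ R.shifts) (hτ : τ ∈ R.shifts) :
    σ * τ = τ * σ := by
  have h := Subgroup.isMulCommutative_closure (k := Set.range R.shift) (by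
    rintro _ ⟨y, rfl⟩ _ ⟨z, rfl⟩
    exact R.shift_comm y z)
  exact congrArg Subtype.val (h.is_comm.comm (⟨σ, hσ⟩ : R.shifts) ⟨τ, hτ⟩)

theorem exists_shift (g : G) : ∃ τ ∈ R.shifts, τ 1 = g := by
  have hg : g ∈ Subgroup.closure (Set.range R.ι) := by rw [R.gen]; trivial
  induction hg using Subgroup.closure_induction_right with
  | one => exact ⟨1, one_mem _, rfl⟩
  | mul_right g _ x hx ih =>
    obtain ⟨x, rfl⟩ := hx
    obtain ⟨τ, hτ, h⟩ := ih
    refine ⟨R.shift (R.act g x) * τ, mul_mem (Subgroup.subset_closure ⟨_, rfl⟩) hτ, ?_⟩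
    rw [Equiv.Perm.mul_apply, h, shift_apply]; simp
  | mul_inv_cancel g _ x hx ih =>
    obtain ⟨x, rfl⟩ := hx
    obtain ⟨τ, hτ, h⟩ := ih
    refine ⟨(R.shift (R.act g (S.diag x)))⁻¹ * τ,
      mul_mem (inv_mem (Subgroup.subset_closure ⟨_, rfl⟩)) hτ, ?_⟩
    rw [Equiv.Perm.mul_apply, h, Equiv.Perm.inv_eq_iff_eq, shift_apply, map_mul, map_inv,
      R.act_ι, mul_inv_rev, inv_inv, Equiv.Perm.mul_apply]
    simp [sigma_diag]

theorem shift_ext {σ τ : Equiv.Perm G} (hσ : σ ∈ R.shifts) (hτ : τ ∈ R.shifts)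
    (h : σ 1 = τ 1) : σ = τ := by
  ext g
  obtain ⟨ρ, hρ, rfl⟩ := R.exists_shift g
  rw [← Equiv.Perm.mul_apply, ← Equiv.Perm.mul_apply, R.shifts_comm hσ hρ,
    R.shifts_comm hτ hρ, Equiv.Perm.mul_apply, Equiv.Perm.mul_apply, h]

/-- The unique element of `shifts` sending `1` to `g`; it becomes the translation `h ↦ g + h`. -/
noncomputable def transl (g : G) : Equiv.Perm G := (R.exists_shift g).choose

theorem transl_mem (g : G) : R.transl g ∈ R.shifts := (R.exists_shift g).choose_spec.1

theorem transl_one (g : G) : R.transl g 1 = g := (R.exists_shift g).choose_spec.2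

theorem eq_transl {τ : Equiv.Perm G} (hτ : τ ∈ R.shifts) : τ = R.transl (τ 1) :=
  R.shift_ext hτ (R.transl_mem _) (R.transl_one _).symm

theorem transl_transl (a b : G) : R.transl (R.transl a b) = R.transl a * R.transl b := by
  rw [R.eq_transl (mul_mem (R.transl_mem a) (R.transl_mem b)), Equiv.Perm.mul_apply,
    R.transl_one]

theorem transl_comm (a b : G) : R.transl a b = R.transl b a := by
  have h := R.shifts_comm (R.transl_mem a) (R.transl_mem b)
  have h1 := congrArg (fun τ : Equiv.Perm G => τ 1) h
  simpa [R.transl_one] using h1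

theorem transl_ι (x : X) : R.transl (R.ι x) = R.shift x := by
  have h : R.shift x ∈ R.shifts := Subgroup.subset_closure ⟨x, rfl⟩
  have h1 := R.eq_transl h
  rw [shift_apply] at h1
  simpa using h1.symm

theorem conj_mem (g : G) {τ : Equiv.Perm G} (hτ : τ ∈ R.shifts) :
    Equiv.mulLeft g * τ * (Equiv.mulLeft g)⁻¹ ∈ R.shifts := by
  induction hτ using Subgroup.closure_induction with
  | mem τ h =>
    obtain ⟨y, rfl⟩ := h
    refine Subgroup.subset_closure ⟨R.act g y, ?_⟩
    ext h
    simp [shift_apply, ← mul_assoc]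
  | one =>
    rw [mul_one, mul_inv_cancel]
    exact one_mem _
  | mul σ τ _ _ h1 h2 =>
    have h := mul_mem h1 h2
    rwa [conj_mul] at h
  | inv σ _ h =>
    have h := inv_mem h
    rwa [conj_inv] at h

theorem mul_transl (g a b : G) :
    R.transl (g * R.transl a b) g = R.transl (g * a) (g * b) := by
  set c := Equiv.mulLeft g * R.transl a * (Equiv.mulLeft g)⁻¹ with hc
  have hm : c ∈ R.shifts := R.conj_mem g (R.transl_mem a)
  have hcg : ∀ h, c (g * h) = g * R.transl a h := by intro h; simp [hc]
  clear_value c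
  have h1 : c * R.transl g = R.transl (g * a) := by
    apply R.shift_ext (mul_mem hm (R.transl_mem g)) (R.transl_mem _)
    have := hcg 1
    simpa [R.transl_one] using this
  rw [← h1, ← hcg]
  have h2 : R.transl (c (g * b)) = c * R.transl (g * b) := by
    rw [R.eq_transl (mul_mem hm (R.transl_mem (g * b))), Equiv.Perm.mul_apply, R.transl_one]
  rw [h2, Equiv.Perm.mul_apply, Equiv.Perm.mul_apply, R.transl_comm]

/-- The natural left brace structure on `G`. Its multiplication is the one of `G`, and its addition is
the one for which `g * ι x = g + ι (g x)` (see `brace_mul_ι`), i.e. `λ_g (ι x) = ι (g x)`. -/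
@[reducible] noncomputable def brace : LeftBrace G :=
  { (inferInstance : Group G) with
    add := fun a b => R.transl a b
    zero := 1
    neg := fun a => (R.transl a)⁻¹ 1
    nsmul := @nsmulRec G ⟨1⟩ ⟨fun a b => R.transl a b⟩
    zsmul := @zsmulRec G ⟨1⟩ ⟨fun a b => R.transl a b⟩ ⟨fun a => (R.transl a)⁻¹ 1⟩
      (@nsmulRec G ⟨1⟩ ⟨fun a b => R.transl a b⟩)
    add_assoc := fun a b c => by
      change R.transl (R.transl a b) c = R.transl a (R.transl b c)
      rw [transl_transl]; rfl
    zero_add := fun a => by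
      change R.transl 1 a = a
      rw [R.transl_comm, R.transl_one]
    add_zero := fun a => R.transl_one a
    neg_add_cancel := fun a => by
      change R.transl ((R.transl a)⁻¹ 1) a = 1
      rw [R.transl_comm]; simp
    add_comm := fun a b => R.transl_comm a b
    brace_axiom := fun a b c => R.mul_transl a b c }

theorem brace_add (a b : G) : R.brace.add a b = R.transl a b := rfl

/-- The lambda map: `g ∘ ι x = g + ι (g x)`. -/
theorem brace_mul_ι (g : G) (x : X) :
    g * R.ι x = (letI := R.brace; g + R.ι (R.act g x)) := by
  change _ = R.transl g (R.ι (R.act g x))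
  rw [R.transl_comm, R.transl_ι, R.shift_apply]
  simp

/-- Homomorphisms compatible with `ι` and with the actions preserve the addition. -/
theorem map_transl {G' : Type*} [Group G'] (R' : S.Realization G') (f : G →* G')
    (hι : ∀ x, f (R.ι x) = R'.ι x) (hact : ∀ g, R'.act (f g) = R.act g) (a b : G) :
    f (R.transl a b) = R'.transl (f a) (f b) := by
  have h : ∀ τ ∈ R.shifts, ∃ τ' ∈ R'.shifts, ∀ g, f (τ g) = τ' (f g) := by
    intro τ hτ
    induction hτ using Subgroup.closure_induction with
    | mem τ h =>
      obtain ⟨y, rfl⟩ := h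
      refine ⟨R'.shift y, Subgroup.subset_closure ⟨y, rfl⟩, fun g => ?_⟩
      rw [shift_apply, shift_apply, map_mul, hι, hact]
    | one => exact ⟨1, one_mem _, fun g => rfl⟩
    | mul σ τ _ _ h1 h2 =>
      obtain ⟨σ', hσ, e1⟩ := h1
      obtain ⟨τ', hτ, e2⟩ := h2
      exact ⟨σ' * τ', mul_mem hσ hτ, fun g => by simp [e1, e2]⟩
    | inv σ _ h =>
      obtain ⟨σ', hσ, e1⟩ := h
      refine ⟨σ'⁻¹, inv_mem hσ, fun g => ?_⟩
      rw [Equiv.Perm.eq_inv_iff_eq, ← e1]; simp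
  obtain ⟨τ', hτ', e⟩ := h _ (R.transl_mem a)
  have h1 : τ' 1 = f a := by rw [← map_one f, ← e, R.transl_one]
  rw [e, R'.eq_transl hτ', h1]

end YBSolution.Realization

end

namespace YBSolution

variable {X : Type*} (S : YBSolution X)

/-- The structure group `G(X, r) = gr(x ∈ X | x y = σ_x(y) γ_y(x) for all x, y ∈ X)`. -/
def StructureGroup : Type _ :=
  PresentedGroup {w : FreeGroup X | ∃ x y, w = FreeGroup.of x * FreeGroup.of y *
    (FreeGroup.of (S.sigma x y) * FreeGroup.of (S.gam y x))⁻¹}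

instance : Group S.StructureGroup := inferInstanceAs (Group (PresentedGroup _))

/-- The permutation group `gr(σ_x | x ∈ X)` of `(X, r)`, a subgroup of `Sym_X`. Its natural left brace
structure, installed as an instance below, is the unique one for which the canonical map `φ` from the
structure group is a homomorphism of left braces (`toPermutationGroup_add`,
`toPermutationGroup_surjective`). -/
def PermutationGroup : Type _ := Subgroup.closure (Set.range S.sigma)

instance : Group S.PermutationGroup :=
  inferInstanceAs (Group (Subgroup.closure (Set.range S.sigma)))

/-- The generator `x` of the structure group. -/
def StructureGroup.of (x : X) : S.StructureGroup := PresentedGroup.of x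

/-- The element `σ_x` of the permutation group. -/
noncomputable def PermutationGroup.of (x : X) : S.PermutationGroup :=
  ⟨S.sigma x, Subgroup.subset_closure ⟨x, rfl⟩⟩

/-- The canonical group homomorphism `φ` from the structure group to the permutation group, `x ↦ σ_x`. -/
noncomputable def toPermutationGroup : S.StructureGroup →* S.PermutationGroup :=
  PresentedGroup.toGroup (f := PermutationGroup.of S) (by
    rintro _ ⟨x, y, rfl⟩
    simp only [map_mul, map_inv, FreeGroup.lift_apply_of]
    rw [mul_inv_eq_one]
    exact Subtype.ext (S.sigma_mul x y))

theorem toPermutationGroup_of (x : X) :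
    S.toPermutationGroup (StructureGroup.of S x) = PermutationGroup.of S x :=
  PresentedGroup.toGroup.of _

/-- The inclusion of the permutation group in `Sym_X`. -/
def PermutationGroup.toPerm : S.PermutationGroup →* Equiv.Perm X :=
  (Subgroup.closure (Set.range S.sigma)).subtype

/-- The permutation group, generated by the `σ_x`. -/
noncomputable def permRealization : S.Realization S.PermutationGroup where
  ι := PermutationGroup.of S
  act := PermutationGroup.toPerm S
  act_ι _ := rfl
  gen := by
    have h := Subgroup.closure_closure_coe_preimage (k := Set.range S.sigma)
    have e : Set.range (PermutationGroup.of S) =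
        ((↑) : Subgroup.closure (Set.range S.sigma) → Equiv.Perm X) ⁻¹' Set.range S.sigma := by
      ext g
      constructor
      · rintro ⟨x, rfl⟩
        exact ⟨x, rfl⟩
      · rintro ⟨x, hx⟩
        exact ⟨x, Subtype.ext hx⟩
    rw [e]
    exact h
  rel x y := Subtype.ext (S.sigma_mul x y)

/-- The structure group, generated by `X`, acting on `X` through `φ`. -/
noncomputable def structureRealization : S.Realization S.StructureGroup where
  ι := StructureGroup.of S
  act := (PermutationGroup.toPerm S).comp S.toPermutationGroup
  act_ι x := by rw [MonoidHom.comp_apply, toPermutationGroup_of]; rfl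
  gen := PresentedGroup.closure_range_of _
  rel x y := by
    have h : PresentedGroup.mk {w : FreeGroup X | ∃ x y, w = FreeGroup.of x * FreeGroup.of y *
        (FreeGroup.of (S.sigma x y) * FreeGroup.of (S.gam y x))⁻¹}
        (FreeGroup.of x * FreeGroup.of y *
        (FreeGroup.of (S.sigma x y) * FreeGroup.of (S.gam y x))⁻¹) = 1 :=
      PresentedGroup.one_of_mem ⟨x, y, rfl⟩
    rw [map_mul, map_inv, mul_inv_eq_one, map_mul, map_mul] at h
    exact h

/-- The natural left brace structure of the structure group, with `λ_x y = σ_x y` on generators. -/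
noncomputable instance : LeftBrace S.StructureGroup := S.structureRealization.brace

/-- The natural left brace structure of the permutation group. -/
noncomputable instance : LeftBrace S.PermutationGroup := S.permRealization.brace

theorem StructureGroup.lam_of (x y : X) :
    LeftBrace.lam (StructureGroup.of S x) (StructureGroup.of S y) =
      StructureGroup.of S (S.sigma x y) := by
  have h := S.structureRealization.brace_mul_ι (StructureGroup.of S x) y
  have h1 : S.structureRealization.act (StructureGroup.of S x) = S.sigma x :=
    S.structureRealization.act_ι x
  rw [h1] at h
  exact neg_add_eq_iff_eq_add.2 h

/-- `φ` is a homomorphism of left braces. -/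
theorem toPermutationGroup_add (a b : S.StructureGroup) :
    S.toPermutationGroup (a + b) = S.toPermutationGroup a + S.toPermutationGroup b :=
  S.structureRealization.map_transl S.permRealization S.toPermutationGroup
    S.toPermutationGroup_of (fun _ => rfl) a b

theorem toPermutationGroup_surjective : Surjective S.toPermutationGroup := by
  rw [← MonoidHom.range_eq_top, eq_top_iff, ← S.permRealization.gen, Subgroup.closure_le]
  rintro _ ⟨x, rfl⟩
  exact ⟨_, S.toPermutationGroup_of x⟩

end YBSolution

/-- The restriction of a solution to a subset `Y` that all `σ_x` and `γ_y` with `x, y ∈ Y` map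
bijectively onto itself. -/
def YBSolution.restrict {X : Type*} (S : YBSolution X) (Y : Set X)
    (hl : ∀ x ∈ Y, Set.BijOn (S.sigma x) Y Y) (hr : ∀ y ∈ Y, Set.BijOn (S.gam y) Y Y) :
    YBSolution Y where
  r p := (⟨(S.r (p.1, p.2)).1, (hl _ p.1.2).mapsTo p.2.2⟩,
    ⟨(S.r (p.1, p.2)).2, (hr _ p.2.2).mapsTo p.1.2⟩)
  invol p := by
    have h := S.invol (p.1, p.2)
    ext
    · exact congrArg Prod.fst h
    · exact congrArg Prod.snd h
  left_bij x := (hl _ x.2).bijective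
  right_bij y := (hr _ y.2).bijective
  braid p := by
    have h := S.braid (p.1, p.2.1, p.2.2)
    ext
    · exact congrArg (fun q => q.1) h
    · exact congrArg (fun q => q.2.1) h
    · exact congrArg (fun q => q.2.2) h

/-- The semidirect product `A ⋊ T` of the trivial left braces on an abelian group `A` (written
additively) and an abelian group `T` (written multiplicatively), where `T` acts on `A` by
automorphisms through `φ`. Group automorphisms of `A` are the same as `ℤ`-linear ones; they form the
group `A ≃ₗ[ℤ] A` under composition. The operations are
`(a, τ) + (c, υ) = (a + c, τ υ)` and `(a, τ) ∘ (c, υ) = (a + φ_τ(c), τ υ)`. -/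
@[ext] structure SemidirectBrace {A T : Type*} [AddCommGroup A] [CommGroup T]
    (φ : T →* (A ≃ₗ[ℤ] A)) where
  fst : A
  snd : T

namespace SemidirectBrace

variable {A T : Type*} [AddCommGroup A] [CommGroup T] {φ : T →* (A ≃ₗ[ℤ] A)}

instance : Add (SemidirectBrace φ) := ⟨fun p q => ⟨p.fst + q.fst, p.snd * q.snd⟩⟩
instance : Zero (SemidirectBrace φ) := ⟨⟨0, 1⟩⟩
instance : Neg (SemidirectBrace φ) := ⟨fun p => ⟨-p.fst, p.snd⁻¹⟩⟩
instance : Mul (SemidirectBrace φ) := ⟨fun p q => ⟨p.fst + φ p.snd q.fst, p.snd * q.snd⟩⟩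
instance : One (SemidirectBrace φ) := ⟨⟨0, 1⟩⟩
instance : Inv (SemidirectBrace φ) := ⟨fun p => ⟨-(φ p.snd⁻¹ p.fst), p.snd⁻¹⟩⟩

@[simp] theorem add_fst (p q : SemidirectBrace φ) : (p + q).fst = p.fst + q.fst := rfl
@[simp] theorem add_snd (p q : SemidirectBrace φ) : (p + q).snd = p.snd * q.snd := rfl
@[simp] theorem zero_fst : (0 : SemidirectBrace φ).fst = 0 := rfl
@[simp] theorem zero_snd : (0 : SemidirectBrace φ).snd = 1 := rfl
@[simp] theorem neg_fst (p : SemidirectBrace φ) : (-p).fst = -p.fst := rfl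
@[simp] theorem neg_snd (p : SemidirectBrace φ) : (-p).snd = p.snd⁻¹ := rfl
@[simp] theorem mul_fst (p q : SemidirectBrace φ) : (p * q).fst = p.fst + φ p.snd q.fst := rfl
@[simp] theorem mul_snd (p q : SemidirectBrace φ) : (p * q).snd = p.snd * q.snd := rfl
@[simp] theorem one_fst : (1 : SemidirectBrace φ).fst = 0 := rfl
@[simp] theorem one_snd : (1 : SemidirectBrace φ).snd = 1 := rfl
@[simp] theorem inv_fst (p : SemidirectBrace φ) : p⁻¹.fst = -(φ p.snd⁻¹ p.fst) := rfl
@[simp] theorem inv_snd (p : SemidirectBrace φ) : p⁻¹.snd = p.snd⁻¹ := rfl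

instance : LeftBrace (SemidirectBrace φ) where
  add_assoc p q s := by ext <;> simp [add_assoc, mul_assoc]
  zero_add p := by ext <;> simp
  add_zero p := by ext <;> simp
  neg_add_cancel p := by ext <;> simp
  add_comm p q := by ext <;> simp [add_comm, mul_comm]
  nsmul := nsmulRec
  zsmul := zsmulRec
  mul_assoc p q s := by ext <;> simp [add_assoc, mul_assoc]
  one_mul p := by ext <;> simp
  mul_one p := by ext <;> simp
  inv_mul_cancel p := by ext <;> simp
  brace_axiom p q s := by
    ext
    · simp only [add_fst, mul_fst, map_add]; abel
    · simp only [add_snd, mul_snd]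
      rw [mul_assoc, mul_assoc, mul_assoc, mul_comm s.snd p.snd]

theorem lam_eq (p q : SemidirectBrace φ) : LeftBrace.lam p q = ⟨φ p.snd q.fst, q.snd⟩ := by
  ext <;> simp [LeftBrace.lam]

end SemidirectBrace

/-- The data of an asymmetric product of the trivial left brace on an abelian group `H` by a left brace
`S`: a homomorphism `α` from the multiplicative group of `S` to `Aut(H, +)` and a symmetric bilinear
map `b : H × H → (S, +)` with `λ_s (b f h) = b (α_s f) (α_s h)`. -/
structure AsymmetricDatum (H S : Type*) [AddCommGroup H] [LeftBrace S] where
  α : S →* (H ≃ₗ[ℤ] H)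
  b : H →+ H →+ S
  symm : ∀ f h, b f h = b h f
  equivariant : ∀ s f h, LeftBrace.lam s (b f h) = b (α s f) (α s h)

/-- The asymmetric product `H ⋊_∘ S` via `α` and `b`: the left brace on the set `H × S` with
`(f, s) ∘ (h, u) = (f + α_s h, s ∘ u)` and `(f, s) + (h, u) = (f + h, s + u + b f h)`. -/
@[ext] structure AsymmetricProduct {H S : Type*} [AddCommGroup H] [LeftBrace S]
    (D : AsymmetricDatum H S) where
  fst : H
  snd : S

namespace AsymmetricProduct

variable {H S : Type*} [AddCommGroup H] [LeftBrace S] {D : AsymmetricDatum H S}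

instance : Add (AsymmetricProduct D) :=
  ⟨fun p q => ⟨p.fst + q.fst, p.snd + q.snd + D.b p.fst q.fst⟩⟩
instance : Zero (AsymmetricProduct D) := ⟨⟨0, 0⟩⟩
instance : Neg (AsymmetricProduct D) :=
  ⟨fun p => ⟨-p.fst, -p.snd + D.b p.fst p.fst⟩⟩
instance : Mul (AsymmetricProduct D) :=
  ⟨fun p q => ⟨p.fst + D.α p.snd q.fst, p.snd * q.snd⟩⟩
instance : One (AsymmetricProduct D) := ⟨⟨0, 1⟩⟩
instance : Inv (AsymmetricProduct D) :=
  ⟨fun p => ⟨-(D.α p.snd⁻¹ p.fst), p.snd⁻¹⟩⟩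

@[simp] theorem add_fst (p q : AsymmetricProduct D) : (p + q).fst = p.fst + q.fst := rfl
@[simp] theorem add_snd (p q : AsymmetricProduct D) :
    (p + q).snd = p.snd + q.snd + D.b p.fst q.fst := rfl
@[simp] theorem zero_fst : (0 : AsymmetricProduct D).fst = 0 := rfl
@[simp] theorem zero_snd : (0 : AsymmetricProduct D).snd = 0 := rfl
@[simp] theorem neg_fst (p : AsymmetricProduct D) : (-p).fst = -p.fst := rfl
@[simp] theorem neg_snd (p : AsymmetricProduct D) :
    (-p).snd = -p.snd + D.b p.fst p.fst := rfl
@[simp] theorem mul_fst (p q : AsymmetricProduct D) :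
    (p * q).fst = p.fst + D.α p.snd q.fst := rfl
@[simp] theorem mul_snd (p q : AsymmetricProduct D) : (p * q).snd = p.snd * q.snd := rfl
@[simp] theorem one_fst : (1 : AsymmetricProduct D).fst = 0 := rfl
@[simp] theorem one_snd : (1 : AsymmetricProduct D).snd = 1 := rfl
@[simp] theorem inv_fst (p : AsymmetricProduct D) : p⁻¹.fst = -(D.α p.snd⁻¹ p.fst) := rfl
@[simp] theorem inv_snd (p : AsymmetricProduct D) : p⁻¹.snd = p.snd⁻¹ := rfl

instance : LeftBrace (AsymmetricProduct D) where
  add_assoc p q s := by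
    ext
    · simp [add_assoc]
    · simp only [add_snd, add_fst, map_add, AddMonoidHom.add_apply]; abel
  zero_add p := by ext <;> simp
  add_zero p := by ext <;> simp
  neg_add_cancel p := by
    ext
    · simp
    · simp only [add_snd, neg_snd, neg_fst, map_neg, AddMonoidHom.neg_apply, zero_snd]; abel
  add_comm p q := by
    ext
    · simp [add_comm]
    · simp only [add_snd]
      rw [D.symm, add_comm p.snd]
  nsmul := nsmulRec
  zsmul := zsmulRec
  mul_assoc p q s := by ext <;> simp [add_assoc, mul_assoc]
  one_mul p := by ext <;> simp
  mul_one p := by ext <;> simp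
  inv_mul_cancel p := by ext <;> simp
  brace_axiom p q s := by
    ext
    · simp only [add_fst, mul_fst, map_add]; abel
    · simp only [add_fst, add_snd, mul_fst, mul_snd, map_add, AddMonoidHom.add_apply]
      rw [← D.equivariant, D.symm p.fst (D.α p.snd s.fst), LeftBrace.mul_add',
        LeftBrace.mul_add', LeftBrace.mul_eq p.snd (D.b _ _)]
      abel

theorem lam_eq (p q : AsymmetricProduct D) :
    LeftBrace.lam p q = ⟨D.α p.snd q.fst,
      LeftBrace.lam p.snd q.snd - D.b p.fst (D.α p.snd q.fst)⟩ := by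
  rw [LeftBrace.lam, neg_add_eq_iff_eq_add]
  ext
  · simp
  · simp only [mul_snd, add_snd, LeftBrace.mul_eq p.snd]; abel

end AsymmetricProduct

namespace AsymmetricDatum

variable {H S : Type*} [AddCommGroup H] [LeftBrace S] (D : AsymmetricDatum H S)

/-- The radical `H₁ = {f | b f h = 0 for all h}` of the bilinear map `b`. -/
def radical : AddSubgroup H where
  carrier := {f | ∀ h, D.b f h = 0}
  zero_mem' := by simp
  add_mem' := by
    intro f g hf hg h
    rw [map_add, AddMonoidHom.add_apply, hf h, hg h, add_zero]
  neg_mem' := by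
    intro f hf h
    rw [map_neg, AddMonoidHom.neg_apply, hf h, neg_zero]

theorem mem_radical {f : H} : f ∈ D.radical ↔ ∀ h, D.b f h = 0 := Iff.rfl

theorem α_mem_radical (s : S) {f : H} (hf : f ∈ D.radical) : D.α s f ∈ D.radical := by
  intro h
  have h1 := D.equivariant s f (D.α s⁻¹ h)
  rw [hf, LeftBrace.lam_zero, ← LinearEquiv.mul_apply, ← map_mul, mul_inv_cancel, map_one] at h1
  exact h1.symm

/-- The endomorphism of `H ⧸ H₁` induced by `α_s`. -/
def αBarHom (s : S) : H ⧸ D.radical →+ H ⧸ D.radical :=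
  QuotientAddGroup.map D.radical D.radical (D.α s : H →+ H) fun _ hf => D.α_mem_radical s hf

/-- The homomorphism `S → Aut(H ⧸ H₁)` induced by `α`: `s ↦ (f + H₁ ↦ α_s f + H₁)`. -/
def αBar : S →* ((H ⧸ D.radical) ≃ₗ[ℤ] (H ⧸ D.radical)) where
  toFun s := AddEquiv.toIntLinearEquiv
    { D.αBarHom s with
      invFun := D.αBarHom s⁻¹
      left_inv := by
        intro x
        induction x using QuotientAddGroup.induction_on with
        | H f =>
          change ((D.α s⁻¹ (D.α s f) : H) : H ⧸ D.radical) = f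
          rw [← LinearEquiv.mul_apply, ← map_mul, inv_mul_cancel, map_one]; rfl
      right_inv := by
        intro x
        induction x using QuotientAddGroup.induction_on with
        | H f =>
          change ((D.α s (D.α s⁻¹ f) : H) : H ⧸ D.radical) = f
          rw [← LinearEquiv.mul_apply, ← map_mul, mul_inv_cancel, map_one]; rfl }
  map_one' := by
    ext x
    induction x using QuotientAddGroup.induction_on with
    | H f =>
      change ((D.α 1 f : H) : H ⧸ D.radical) = f
      rw [map_one]; rfl
  map_mul' s u := by
    ext x
    induction x using QuotientAddGroup.induction_on with
    | H f =>
      change ((D.α (s * u) f : H) : H ⧸ D.radical) = (D.α s (D.α u f) : H)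
      rw [map_mul]; rfl

/-- The bilinear map induced by `b` on `H ⧸ H₁`. -/
def bBar : H ⧸ D.radical →+ H ⧸ D.radical →+ S :=
  QuotientAddGroup.lift D.radical
    { toFun := fun f => QuotientAddGroup.lift D.radical (D.b f) fun h hh => by
        rw [AddMonoidHom.mem_ker, D.symm]; exact hh f
      map_zero' := by
        ext h
        change D.b 0 h = 0
        simp
      map_add' := fun f g => by
        ext h
        change D.b (f + g) h = D.b f h + D.b g h
        simp }
    fun f hf => by
      rw [AddMonoidHom.mem_ker]
      ext h
      exact hf h

/-- The induced data `(ᾱ, b̄)` on `H ⧸ H₁`. -/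
def modRadical : AsymmetricDatum (H ⧸ D.radical) S where
  α := D.αBar
  b := D.bBar
  symm x y := by
    induction x using QuotientAddGroup.induction_on with
    | H f =>
      induction y using QuotientAddGroup.induction_on with
      | H h => exact D.symm f h
  equivariant s x y := by
    induction x using QuotientAddGroup.induction_on with
    | H f =>
      induction y using QuotientAddGroup.induction_on with
      | H h => exact D.equivariant s f h

theorem modRadical_α (s : S) (f : H) :
    D.modRadical.α s (f : H ⧸ D.radical) = (D.α s f : H) := rfl

theorem modRadical_b (f h : H) :
    D.modRadical.b (f : H ⧸ D.radical) (h : H ⧸ D.radical) = D.b f h := rfl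

end AsymmetricDatum

/-- The standing data on an abelian group `A`: an automorphism `t` of `A` with `t - id` invertible, and
a family `j` of elements of `A` with `j_{-a} = j_a` and
`j_{t^z(a)} = t^z(j_a) - (t^z - id)(j_0)` for all `z ∈ ℤ`. -/
structure SolutionData (A : Type*) [AddCommGroup A] where
  t : A ≃ₗ[ℤ] A
  sub_id_bij : Bijective fun a => t a - a
  j : A → A
  j_neg : ∀ a, j (-a) = j a
  j_zpow : ∀ (z : ℤ) (a : A), j ((t ^ z) a) = (t ^ z) (j a) - ((t ^ z) (j 0) - j 0)

namespace SolutionData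

variable {A : Type*} [AddCommGroup A] (D : SolutionData A)

section Square

/-- The permutation `σ_{(a₁,a₂)}(c₁, c₂) = (t(c₁) + a₂, t(c₂ - j_{t(c₁)+a₂-a₁}))` of `A²`. -/
def squareSigma (a : A × A) : Equiv.Perm (A × A) where
  toFun c := (D.t c.1 + a.2, D.t (c.2 - D.j (D.t c.1 + a.2 - a.1)))
  invFun c := (D.t.symm (c.1 - a.2), D.t.symm c.2 + D.j (c.1 - a.1))
  left_inv c := by simp
  right_inv c := by simp

theorem squareSigma_inv (a c : A × A) : (D.squareSigma a)⁻¹ c =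
    (D.t.symm (c.1 - a.2), D.t.symm c.2 + D.j (c.1 - a.1)) := rfl

theorem j_t (a : A) : D.j (D.t a) = D.t (D.j a) - (D.t (D.j 0) - D.j 0) := by
  simpa using D.j_zpow 1 a

theorem t_j (a : A) : D.t (D.j a) = D.j (D.t a) + (D.t (D.j 0) - D.j 0) := by
  rw [D.j_t, sub_add_cancel]

/-- The solution `(A², r)` with `r (a, c) = (σ_a c, σ_{σ_a c}⁻¹ a)`. -/
def square : YBSolution (A × A) :=
  YBSolution.ofSigma D.squareSigma
    (by
      rintro ⟨a₁, a₂⟩ ⟨c₁, c₂⟩ ⟨x, y⟩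
      rw [squareSigma_inv, squareSigma_inv]
      have e : D.j (a₁ - c₁) = D.j (c₁ - a₁) := by rw [← D.j_neg, neg_sub]
      simp only [squareSigma, Equiv.coe_fn_mk, e]
      ext
      · simp only [map_add, LinearEquiv.apply_symm_apply]; abel
      · generalize D.j (c₁ - a₁) = w
        have h1 := D.t_j (D.t x + (D.t.symm c₂ + w) - D.t.symm (c₁ - a₂))
        have h2 := D.t_j (D.t x + (D.t.symm a₂ + w) - D.t.symm (a₁ - c₂))
        have e1 : D.t (D.t x + (D.t.symm c₂ + w) - D.t.symm (c₁ - a₂)) =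
            D.t (D.t x + (D.t.symm a₂ + w)) + c₂ - c₁ := by
          simp only [map_add, map_sub, LinearEquiv.apply_symm_apply]; abel
        have e2 : D.t (D.t x + (D.t.symm a₂ + w) - D.t.symm (a₁ - c₂)) =
            D.t (D.t x + (D.t.symm c₂ + w)) + a₂ - a₁ := by
          simp only [map_add, map_sub, LinearEquiv.apply_symm_apply]; abel
        rw [e1] at h1
        rw [e2] at h2
        change D.t (D.t (y - _) - _) = D.t (D.t (y - _) - _)
        rw [map_sub D.t y, map_sub D.t y, h1, h2]
        congr 1
        abel)
    (by
      have h : (fun a : A × A => (D.squareSigma a)⁻¹ a) =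
          fun a => (D.t.symm (a.1 - a.2), D.t.symm a.2 + D.j 0) := by
        funext a
        rw [squareSigma_inv, sub_self]
      rw [h, Function.bijective_iff_has_inverse]
      refine ⟨fun a => (D.t (a.1 + a.2 - D.j 0), D.t (a.2 - D.j 0)), fun a => ?_, fun a => ?_⟩
      · ext
        · simp only [map_add, map_sub, LinearEquiv.apply_symm_apply]; abel
        · simp
      · ext
        · simp
        · simp)

end Square

/-- The subgroup `T = ⟨t⟩` of `Aut(A)`. -/
def T : Subgroup (A ≃ₗ[ℤ] A) := Subgroup.zpowers D.t

instance : CommGroup D.T :=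
  { (inferInstance : Group D.T) with
    mul_comm := (Subgroup.zpowers_isMulCommutative D.t).is_comm.comm }

theorem T_comm (τ : D.T) (x : A) : (τ : A ≃ₗ[ℤ] A) (D.t x) = D.t ((τ : A ≃ₗ[ℤ] A) x) := by
  have h := congrArg Subtype.val (mul_comm τ (⟨D.t, Subgroup.mem_zpowers _⟩ : D.T))
  exact congrArg (fun e : A ≃ₗ[ℤ] A => e x) h

theorem j_T (τ : D.T) (a : A) : D.j ((τ : A ≃ₗ[ℤ] A) a) =
    (τ : A ≃ₗ[ℤ] A) (D.j a) - ((τ : A ≃ₗ[ℤ] A) (D.j 0) - D.j 0) := by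
  obtain ⟨_, z, rfl⟩ := τ
  exact D.j_zpow z a

/-- The left brace `A₁ = A ⋊ T`, the semidirect product of the trivial left braces on `A` and `T`. -/
abbrev A₁ : Type _ := SemidirectBrace D.T.subtype

/-- The automorphism `t - id` of `A`. -/
noncomputable def tSubId : A ≃ₗ[ℤ] A :=
  LinearEquiv.ofBijective ((D.t : A →ₗ[ℤ] A) - LinearMap.id) D.sub_id_bij

theorem tSubId_apply (x : A) : D.tSubId x = D.t x - x := rfl

theorem T_comm_tSubId_symm (τ : D.T) (x : A) :
    (τ : A ≃ₗ[ℤ] A) (D.tSubId.symm x) = D.tSubId.symm ((τ : A ≃ₗ[ℤ] A) x) := by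
  rw [LinearEquiv.eq_symm_apply, tSubId_apply, ← D.T_comm, ← map_sub, ← tSubId_apply,
    LinearEquiv.apply_symm_apply]

/-- For `τ = t^z`, the element `(t - id)⁻²(t^{z+1} - t)(j_0)` of `A`. -/
noncomputable def offset (τ : D.T) : A :=
  D.tSubId.symm (D.tSubId.symm (D.t ((τ : A ≃ₗ[ℤ] A) (D.j 0)) - D.t (D.j 0)))

theorem offset_mul (τ υ : D.T) :
    D.offset (τ * υ) = D.offset τ + (τ : A ≃ₗ[ℤ] A) (D.offset υ) := by
  simp only [offset, D.T_comm_tSubId_symm, ← map_add]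
  congr 2
  simp [D.T_comm]

theorem offset_one : D.offset 1 = 0 := by simp [offset]

/-- The bijection `g_{(a,t^z)}(x) = t^{-z}(x - a - (t - id)⁻²(t^{z+1} - t)(j_0))` of `A`. -/
noncomputable def g (p : D.A₁) : Equiv.Perm A where
  toFun x := (p.snd : A ≃ₗ[ℤ] A).symm (x - p.fst - D.offset p.snd)
  invFun x := (p.snd : A ≃ₗ[ℤ] A) x + p.fst + D.offset p.snd
  left_inv x := by
    dsimp only
    rw [LinearEquiv.apply_symm_apply]
    abel
  right_inv x := by
    dsimp only
    rw [LinearEquiv.symm_apply_eq]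
    abel

theorem g_symm_apply (p : D.A₁) (x : A) :
    (D.g p).symm x = (p.snd : A ≃ₗ[ℤ] A) x + p.fst + D.offset p.snd := rfl

theorem g_symm_one : (D.g 1).symm = Equiv.refl A := by
  ext x; simp [g_symm_apply, offset_one]

theorem g_symm_mul (p q : D.A₁) : (D.g (p * q)).symm = (D.g q).symm.trans (D.g p).symm := by
  ext x
  simp only [g_symm_apply, Equiv.trans_apply, SemidirectBrace.mul_fst, SemidirectBrace.mul_snd,
    offset_mul, map_add, Subgroup.coe_mul, LinearEquiv.mul_apply, Subgroup.subtype_apply]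
  abel

variable (A) in
/-- The group of finitely supported functions `A → ℤ/(n)`, where `n` is the exponent of `A`. -/
abbrev H' : Type _ := A →₀ ZMod (AddMonoid.exponent A)

variable (A) in
/-- The `ℤ/(n)`-module structure of `A`, where `n` is the exponent of `A`. -/
@[reducible] noncomputable def exponentModule : Module (ZMod (AddMonoid.exponent A)) A :=
  AddCommGroup.zmodModule AddMonoid.exponent_nsmul_eq_zero

attribute [local instance] exponentModule

/-- The homomorphism from `(A₁, ∘)` to the automorphisms of `H' A`, `(a, t^z) ↦ (f ↦ f ∘ g_{(a,t^z)})`. -/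
noncomputable def α' : D.A₁ →* (H' A ≃ₗ[ℤ] H' A) where
  toFun p := AddEquiv.toIntLinearEquiv (Finsupp.domCongr (D.g p).symm)
  map_one' := by
    ext1 f
    change Finsupp.equivMapDomain (D.g 1).symm f = f
    rw [g_symm_one, Finsupp.equivMapDomain_refl]
  map_mul' p q := by
    ext1 f
    change Finsupp.equivMapDomain (D.g (p * q)).symm f =
      Finsupp.equivMapDomain (D.g p).symm (Finsupp.equivMapDomain (D.g q).symm f)
    rw [g_symm_mul, Finsupp.equivMapDomain_trans]

theorem α'_eq (p : D.A₁) (f : H' A) :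
    D.α' p f = Finsupp.equivMapDomain (D.g p).symm f := rfl

theorem α'_apply (p : D.A₁) (f : H' A) (x : A) : D.α' p f x = f (D.g p x) := rfl

/-- The sum `∑_{x,y ∈ A} f(x) h(y) t(j_{x-y} - j_0)`. -/
noncomputable def form (f h : H' A) : A :=
  f.sum fun x m => h.sum fun y k => (m * k) • D.t (D.j (x - y) - D.j 0)

theorem form_add_left (f₁ f₂ h : H' A) : D.form (f₁ + f₂) h = D.form f₁ h + D.form f₂ h := by
  apply Finsupp.sum_add_index'
  · intro x; simp
  · intro x m₁ m₂; simp [add_mul, add_smul]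

theorem form_comm (f h : H' A) : D.form f h = D.form h f := by
  rw [form, form, Finsupp.sum_comm]
  refine Finsupp.sum_congr fun y _ => Finsupp.sum_congr fun x _ => ?_
  rw [mul_comm, ← D.j_neg (x - y), neg_sub]

theorem form_α' (p : D.A₁) (f h : H' A) :
    D.form (D.α' p f) (D.α' p h) = (p.snd : A ≃ₗ[ℤ] A) (D.form f h) := by
  simp only [form, α'_eq, Finsupp.sum_equivMapDomain, map_finsuppSum]
  refine Finsupp.sum_congr fun x _ => Finsupp.sum_congr fun y _ => ?_
  rw [ZMod.map_smul, D.T_comm, g_symm_apply, g_symm_apply, add_sub_add_right_eq_sub,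
    add_sub_add_right_eq_sub, ← map_sub, D.j_T, map_sub _ (D.j (x - y))]
  congr 2
  abel

/-- The bilinear form `(f, h) ↦ (∑_{x,y ∈ A} f(x) h(y) t(j_{x-y} - j_0), id)` with values in `A₁`. -/
noncomputable def b' : H' A →+ H' A →+ D.A₁ :=
  AddMonoidHom.mk' (fun f => AddMonoidHom.mk' (fun h => ⟨D.form f h, 1⟩) (by
      intro h₁ h₂
      ext
      · change D.form f (h₁ + h₂) = D.form f h₁ + D.form f h₂
        rw [D.form_comm, form_add_left, D.form_comm h₁, D.form_comm h₂]
      · simp)) (by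
    intro f₁ f₂
    refine AddMonoidHom.ext fun h => SemidirectBrace.ext ?_ ?_
    · exact D.form_add_left f₁ f₂ h
    · simp)

theorem b'_apply (f h : H' A) :
    D.b' f h = ⟨∑ x ∈ f.support, ∑ y ∈ h.support, (f x * h y) • D.t (D.j (x - y) - D.j 0), 1⟩ :=
  rfl

/-- The data of the asymmetric product `B'` of `H' A` by `A₁`. -/
noncomputable def datum : AsymmetricDatum (H' A) D.A₁ where
  α := D.α'
  b := D.b'
  symm f h := SemidirectBrace.ext (D.form_comm f h) rfl
  equivariant p f h := by
    rw [SemidirectBrace.lam_eq]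
    exact SemidirectBrace.ext (D.form_α' p f h).symm rfl

/-- The asymmetric product of the trivial left brace `H' A` by `A₁`. -/
abbrev B' : Type _ := AsymmetricProduct D.datum

/-- The element `(e_{a₁}, (a₂ - t(t - id)⁻¹(j_0), t))` attached to `(a₁, a₂)`. -/
noncomputable def x' (a : A × A) : D.B' :=
  ⟨Finsupp.single a.1 1, ⟨a.2 - D.t (D.tSubId.symm (D.j 0)), ⟨D.t, Subgroup.mem_zpowers D.t⟩⟩⟩

/-- The set of all elements `x' (a₁, a₂)`. -/
def X' : Set D.B' := Set.range D.x'

theorem lam_x' (a c : A × A) : LeftBrace.lam (D.x' a) (D.x' c) = D.x' (D.squareSigma a c) := by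
  have ho : D.offset ⟨D.t, Subgroup.mem_zpowers D.t⟩ = D.t (D.tSubId.symm (D.j 0)) := by
    have h := D.T_comm_tSubId_symm ⟨D.t, Subgroup.mem_zpowers D.t⟩ (D.j 0)
    change D.t _ = D.tSubId.symm (D.t _) at h
    rw [offset, h]
    congr 1
    rw [LinearEquiv.symm_apply_eq, tSubId_apply]
  have hα : D.α' (D.x' a).snd (D.x' c).fst = Finsupp.single (D.t c.1 + a.2) 1 := by
    rw [α'_eq]
    simp only [x']
    rw [Finsupp.equivMapDomain_single, g_symm_apply, ho]
    congr 1
    change D.t c.1 + (a.2 - _) + _ = _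
    abel
  rw [AsymmetricProduct.lam_eq]
  change AsymmetricProduct.mk (D.α' _ _) (_ - D.b' _ (D.α' _ _)) = _
  rw [hα, SemidirectBrace.lam_eq]
  refine AsymmetricProduct.ext rfl (SemidirectBrace.ext ?_ ?_)
  · have hf : D.form (Finsupp.single a.1 1) (Finsupp.single (D.t c.1 + a.2) 1) =
        D.t (D.j (a.1 - (D.t c.1 + a.2)) - D.j 0) := by
      simp [form]
    change D.t (c.2 - D.t (D.tSubId.symm (D.j 0))) +
      -(D.form (Finsupp.single a.1 1) (Finsupp.single (D.t c.1 + a.2) 1)) =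
      D.t (c.2 - D.j (D.t c.1 + a.2 - a.1)) - D.t (D.tSubId.symm (D.j 0))
    have h2 : D.j 0 = D.t (D.tSubId.symm (D.j 0)) - D.tSubId.symm (D.j 0) := by
      rw [← tSubId_apply, LinearEquiv.apply_symm_apply]
    rw [hf, ← D.j_neg (a.1 - _), neg_sub]
    generalize D.j (D.t c.1 + a.2 - a.1) = w
    generalize D.tSubId.symm (D.j 0) = u at *
    rw [h2]
    simp only [map_sub]
    abel
  · change _ * (1 : D.T)⁻¹ = _
    simp [x']

theorem solution_x' (a c : A × A) :
    (LeftBrace.solution D.B').sigma (D.x' a) (D.x' c) = D.x' (D.square.sigma a c) := D.lam_x' a c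

theorem solution_gam_x' (a c : A × A) :
    (LeftBrace.solution D.B').gam (D.x' c) (D.x' a) = D.x' (D.square.gam c a) := by
  rw [YBSolution.gam_eq, Equiv.Perm.inv_eq_iff_eq, solution_x', solution_x', YBSolution.sigma_gam]

theorem sigma_bijOn (x : D.B') (hx : x ∈ D.X') :
    Set.BijOn ((LeftBrace.solution D.B').sigma x) D.X' D.X' := by
  obtain ⟨a, rfl⟩ := hx
  refine ⟨?_, (Equiv.injective _).injOn, ?_⟩
  · rintro _ ⟨c, rfl⟩
    exact ⟨_, (D.solution_x' a c).symm⟩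
  · rintro _ ⟨c, rfl⟩
    exact ⟨_, ⟨(D.square.sigma a)⁻¹ c, rfl⟩, by rw [solution_x']; simp⟩

theorem gam_bijOn (y : D.B') (hy : y ∈ D.X') :
    Set.BijOn ((LeftBrace.solution D.B').gam y) D.X' D.X' := by
  obtain ⟨c, rfl⟩ := hy
  refine ⟨?_, (Equiv.injective _).injOn, ?_⟩
  · rintro _ ⟨a, rfl⟩
    exact ⟨_, (D.solution_gam_x' a c).symm⟩
  · rintro _ ⟨a, rfl⟩
    exact ⟨_, ⟨(D.square.gam c)⁻¹ a, rfl⟩, by rw [solution_gam_x']; simp⟩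

/-- The restriction to `X'` of the solution associated to the left brace `B'`. -/
noncomputable def solution' : YBSolution D.X' :=
  (LeftBrace.solution D.B').restrict D.X' D.sigma_bijOn D.gam_bijOn

end SolutionData

/-!
If a solution `(X, r)` embeds in a left brace `B` as a family of additive generators, then
`𝒢(X, r) ≅ B / Soc(B)`: both are quotients of the structure group of `(X, r)`, and an element of the
structure group fixes `X` pointwise exactly when its image in `B` has trivial lambda map. Both
`(A², r)` and `(X', r')` embed in `B' = H' ⋊_∘ A₁` with image `X'`. As `α'` is faithful, the socle
of `B'` is `H₁`, so that `B' / Soc(B') = H' / H₁ ⋊_∘ A₁`. The order of `t` matters for the additive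
generation of `B'` by `X'`: as it is coprime to `n`, the multiple `n · (e'_a, t) = (0, tⁿ)`
generates `T`.
-/

namespace LeftBrace

variable (B : Type*) [LeftBrace B]

/-- The lambda map of a left brace `B`, as an action of `(B, ∘)` on `(B, +)` by endomorphisms. -/
def lamHom : B →* AddMonoid.End B where
  toFun a := AddMonoidHom.mk' (lam a) (lam_add a)
  map_one' := AddMonoidHom.ext lam_one
  map_mul' a b := AddMonoidHom.ext (lam_mul a b)

/-- The socle `Soc(B) = {a | λ_a = id}` of a left brace `B`. -/
def socle : Subgroup B := (lamHom B).ker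

variable {B}

theorem mem_socle {a : B} : a ∈ socle B ↔ ∀ b, lam a b = b := DFunLike.ext_iff

theorem mem_socle_of_closure_eq_top {a : B} {Y : Set B} (hY : AddSubgroup.closure Y = ⊤)
    (h : ∀ y ∈ Y, lam a y = y) : a ∈ socle B :=
  AddMonoidHom.eq_of_eqOn_dense hY (f := lamHom B a) (g := AddMonoidHom.id B) h

/-- The isomorphism between two left braces that are quotients of a third one by the same ideal. -/
noncomputable def equivOfKerEq {G P C : Type*} [LeftBrace G] [LeftBrace P] [LeftBrace C]
    (φ : G →* P) (hφ_add : ∀ a b, φ (a + b) = φ a + φ b) (hφ : Surjective φ)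
    (ψ : G →* C) (hψ_add : ∀ a b, ψ (a + b) = ψ a + ψ b) (hψ : Surjective ψ)
    (hker : φ.ker = ψ.ker) : P ≃+* C :=
  let e : P ≃* C := (QuotientGroup.quotientKerEquivOfSurjective φ hφ).symm.trans <|
    (QuotientGroup.quotientMulEquivOfEq hker).trans <|
      QuotientGroup.quotientKerEquivOfSurjective ψ hψ
  have he : ∀ g, e (φ g) = ψ g := fun g =>
    congrArg (fun q => QuotientGroup.quotientKerEquivOfSurjective ψ hψ
        (QuotientGroup.quotientMulEquivOfEq hker q))
      ((QuotientGroup.quotientKerEquivOfSurjective φ hφ).symm_apply_apply (g : G ⧸ φ.ker))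
  { e with
    map_add' := hφ.forall₂.2 fun a b => by
      change e (φ a + φ b) = e (φ a) + e (φ b)
      rw [← hφ_add, he, he, he, hψ_add] }

end LeftBrace

namespace YBSolution

open LeftBrace

variable {X B : Type*} [LeftBrace B] {S : YBSolution X} {ι : X → B}

namespace StructureGroup

theorem mul_of (g : S.StructureGroup) (x : X) :
    g * of S x = g + of S (S.structureRealization.act g x) :=
  S.structureRealization.brace_mul_ι g x

@[elab_as_elim]
theorem induction_right {p : S.StructureGroup → Prop} (one : p 1)
    (mul_of : ∀ g x, p g → p (g * of S x)) (mul_of_inv : ∀ g x, p g → p (g * (of S x)⁻¹))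
    (g : S.StructureGroup) : p g := by
  have hg : g ∈ Subgroup.closure (Set.range (of S)) :=
    S.structureRealization.gen.symm ▸ Subgroup.mem_top g
  induction hg using Subgroup.closure_induction_right with
  | one => exact one
  | mul_right g _ y hy hg =>
    obtain ⟨x, rfl⟩ := hy
    exact mul_of g x hg
  | mul_inv_cancel g _ y hy hg =>
    obtain ⟨x, rfl⟩ := hy
    exact mul_of_inv g x hg

/-- The extension of `ι : X → B` with `λ_{ι x} (ι y) = ι (σ_x y)` to the structure group; it is a
homomorphism of left braces by `lift_add`. -/
def lift (hι : ∀ x y, lam (ι x) (ι y) = ι (S.sigma x y)) : S.StructureGroup →* B :=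
  PresentedGroup.toGroup (f := ι) <| by
    rintro _ ⟨x, y, rfl⟩
    simp only [map_mul, map_inv, FreeGroup.lift_apply_of]
    rw [mul_inv_eq_one, mul_eq, mul_eq, hι, hι, sigma_gam, add_comm]

variable (hι : ∀ x y, lam (ι x) (ι y) = ι (S.sigma x y))

theorem lift_of (x : X) : lift hι (of S x) = ι x := PresentedGroup.toGroup.of _

theorem lam_lift (g : S.StructureGroup) (x : X) :
    lam (lift hι g) (ι x) = ι (S.structureRealization.act g x) := by
  induction g using induction_right generalizing x with
  | one => rw [map_one, map_one, lam_one, Equiv.Perm.one_apply]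
  | mul_of g y hg =>
    rw [map_mul, map_mul, lam_mul, lift_of, hι, hg, ← S.structureRealization.act_ι]
    rfl
  | mul_of_inv g y hg =>
    obtain ⟨z, rfl⟩ := (S.sigma y).surjective x
    rw [map_mul, map_inv, lift_of, ← hι, ← lam_mul, inv_mul_cancel_right, hg, map_mul, map_inv,
      ← S.structureRealization.act_ι]
    exact congrArg (fun w => ι (S.structureRealization.act g w))
      ((S.structureRealization.act (of S y)).symm_apply_apply z).symm

theorem lift_add_of (g : S.StructureGroup) (x : X) :
    lift hι (g + of S x) = lift hι g + ι x := by
  obtain ⟨y, rfl⟩ := (S.structureRealization.act g).surjective x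
  rw [← mul_of, map_mul, lift_of, mul_eq, lam_lift]

theorem lift_add (g h : S.StructureGroup) : lift hι (g + h) = lift hι g + lift hι h := by
  induction h using induction_right with
  | one => rw [map_one, ← zero_eq_one, ← zero_eq_one, add_zero, add_zero]
  | mul_of h x ih => rw [mul_of, ← add_assoc, lift_add_of, lift_add_of, ih, add_assoc]
  | mul_of_inv h x ih =>
    set k := h * (of S x)⁻¹
    have hk : h = k + of S (S.structureRealization.act k x) := by
      rw [← mul_of, inv_mul_cancel_right]
    rw [hk, ← add_assoc, lift_add_of, lift_add_of, ← add_assoc] at ih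
    exact add_right_cancel ih

theorem lift_surjective (hgen : AddSubgroup.closure (Set.range ι) = ⊤) :
    Surjective (lift hι) := by
  have hrange : AddSubgroup.closure (Set.range ι) ≤
      (AddMonoidHom.mk' (lift hι) (lift_add hι)).range := by
    rw [AddSubgroup.closure_le]
    rintro _ ⟨x, rfl⟩
    exact ⟨of S x, lift_of hι x⟩
  rw [hgen, top_le_iff] at hrange
  exact AddMonoidHom.range_eq_top.1 hrange

theorem lift_mem_socle_iff (hinj : Injective ι) (hgen : AddSubgroup.closure (Set.range ι) = ⊤)
    {g : S.StructureGroup} : lift hι g ∈ socle B ↔ S.toPermutationGroup g = 1 := by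
  have hfix : S.toPermutationGroup g = 1 ↔ ∀ x, S.structureRealization.act g x = x :=
    Subtype.ext_iff.trans Equiv.ext_iff
  rw [hfix]
  refine ⟨fun h x => hinj ?_, fun h => mem_socle_of_closure_eq_top hgen ?_⟩
  · rw [← lam_lift hι, mem_socle.1 h]
  · rintro _ ⟨x, rfl⟩
    rw [lam_lift, h]

end StructureGroup

/-- The isomorphism `𝒢(X, r) ≅ B / Soc(B)` for a solution `(X, r)` embedded in a left brace `B` as
a family of additive generators; the quotient is given as a surjection `π : B → C` of left braces
with kernel `Soc(B)`. -/
noncomputable def permutationGroupEquiv {C : Type*} [LeftBrace C]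
    (hι : ∀ x y, lam (ι x) (ι y) = ι (S.sigma x y)) (hinj : Injective ι)
    (hgen : AddSubgroup.closure (Set.range ι) = ⊤)
    (π : B →* C) (hπ_add : ∀ a b, π (a + b) = π a + π b) (hπ : Surjective π)
    (hker : π.ker = socle B) : S.PermutationGroup ≃+* C :=
  equivOfKerEq S.toPermutationGroup S.toPermutationGroup_add S.toPermutationGroup_surjective
    (π.comp (StructureGroup.lift hι))
    (fun g h => by
      simp only [MonoidHom.comp_apply, StructureGroup.lift_add, hπ_add])
    (hπ.comp (StructureGroup.lift_surjective hι hgen))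
    (by
      ext g
      rw [← MonoidHom.comap_ker, hker, Subgroup.mem_comap,
        StructureGroup.lift_mem_socle_iff hι hinj hgen, MonoidHom.mem_ker])

end YBSolution

namespace AsymmetricProduct

open LeftBrace

variable {H S : Type*} [AddCommGroup H] [LeftBrace S] (D : AsymmetricDatum H S)

/-- The quotient map `H ⋊_∘ S → H/H₁ ⋊_∘ S`; it is a homomorphism of left braces by
`toModRadical_add`. -/
def toModRadical : AsymmetricProduct D →* AsymmetricProduct D.modRadical where
  toFun p := ⟨p.fst, p.snd⟩
  map_one' := rfl
  map_mul' _ _ := rfl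

theorem toModRadical_add (p q : AsymmetricProduct D) :
    toModRadical D (p + q) = toModRadical D p + toModRadical D q := rfl

theorem toModRadical_surjective : Surjective (toModRadical D) := by
  rintro ⟨F, s⟩
  obtain ⟨f, rfl⟩ := QuotientAddGroup.mk_surjective F
  exact ⟨⟨f, s⟩, rfl⟩

variable {D}

theorem mem_ker_toModRadical {p : AsymmetricProduct D} :
    p ∈ (toModRadical D).ker ↔ p.fst ∈ D.radical ∧ p.snd = 1 := by
  rw [MonoidHom.mem_ker, AsymmetricProduct.ext_iff]
  exact and_congr_left' (QuotientAddGroup.eq_zero_iff p.fst)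

theorem ker_toModRadical (hα : Injective D.α) :
    (toModRadical D).ker = socle (AsymmetricProduct D) := by
  ext ⟨f, s⟩
  rw [mem_ker_toModRadical, mem_socle]
  constructor
  · rintro ⟨hf, rfl : s = 1⟩ ⟨h, u⟩
    rw [lam_eq, map_one, lam_one]
    exact AsymmetricProduct.ext rfl (by simp [D.mem_radical.1 hf])
  · intro hfix
    have hαs : D.α s = 1 := LinearEquiv.ext fun h => by
      simpa [lam_eq] using congrArg fst (hfix (⟨h, 0⟩ : AsymmetricProduct D))
    refine ⟨D.mem_radical.2 fun h => ?_, (map_eq_one_iff D.α hα).1 hαs⟩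
    simpa [lam_eq, lam_zero, hαs] using congrArg snd (hfix (⟨h, 0⟩ : AsymmetricProduct D))

/-- The isomorphism `𝒢(X, r) ≅ H/H₁ ⋊_∘ S` for a solution `(X, r)` embedded in `H ⋊_∘ S` as a family
of additive generators. -/
noncomputable def permutationGroupEquiv {X : Type*} {R : YBSolution X}
    {ι : X → AsymmetricProduct D} (hα : Injective D.α)
    (hι : ∀ x y, lam (ι x) (ι y) = ι (R.sigma x y)) (hinj : Injective ι)
    (hgen : AddSubgroup.closure (Set.range ι) = ⊤) :
    R.PermutationGroup ≃+* AsymmetricProduct D.modRadical :=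
  YBSolution.permutationGroupEquiv hι hinj hgen (toModRadical D) (toModRadical_add D)
    (toModRadical_surjective D) (ker_toModRadical hα)

end AsymmetricProduct

theorem closure_range_single_one (ι : Type*) (n : ℕ) :
    AddSubgroup.closure (Set.range fun i : ι => Finsupp.single i (1 : ZMod n)) = ⊤ := by
  rw [eq_top_iff]
  intro f _
  induction f using Finsupp.induction_linear with
  | zero => exact zero_mem _
  | add f g hf hg => exact add_mem (hf trivial) (hg trivial)
  | single i m =>
    obtain ⟨z, rfl⟩ := ZMod.intCast_surjective m
    rw [← zsmul_one, ← Finsupp.smul_single]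
    exact zsmul_mem (AddSubgroup.subset_closure (Set.mem_range_self i)) z

theorem closure_range_prodMk_eq_top {ι M N : Type*} [Nonempty ι] [AddCommGroup M]
    [AddCommGroup N] {n : ℕ} (hM : ∀ m : M, n • m = 0) {v : ι → M}
    (hv : AddSubgroup.closure (Set.range v) = ⊤) {t : N} (ht : AddSubgroup.zmultiples t = ⊤)
    (hcop : (addOrderOf t).Coprime n) :
    AddSubgroup.closure (Set.range fun i => (v i, t)) = ⊤ := by
  set K := AddSubgroup.closure (Set.range fun i => (v i, t))
  have hmem (i : ι) : (v i, t) ∈ K := AddSubgroup.subset_closure ⟨i, rfl⟩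
  have ht_mem : ((0 : M), t) ∈ K := by
    obtain ⟨i⟩ := ‹Nonempty ι›
    obtain ⟨k, hk⟩ := exists_nsmul_eq_self_of_coprime hcop.symm
    have hsmul : k • n • (v i, t) = (0, t) := Prod.ext (by simp [hM]) hk
    exact hsmul ▸ nsmul_mem (nsmul_mem (hmem i) n) k
  have hinr : (AddMonoidHom.inr M N).range ≤ K := by
    rw [AddMonoidHom.range_eq_map, ← ht, AddMonoidHom.map_zmultiples]
    exact AddSubgroup.zmultiples_le_of_mem ht_mem
  have hinl : (AddMonoidHom.inl M N).range ≤ K := by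
    rw [AddMonoidHom.range_eq_map, ← hv, AddMonoidHom.map_closure, AddSubgroup.closure_le]
    rintro _ ⟨_, ⟨i, rfl⟩, rfl⟩
    simpa using sub_mem (hmem i) ht_mem
  rw [eq_top_iff]
  rintro ⟨m, s⟩ _
  simpa using add_mem (hinl ⟨m, rfl⟩) (hinr ⟨s, rfl⟩)

namespace SolutionData

variable {A : Type*} [AddCommGroup A] (D : SolutionData A)

variable (A) in
theorem single_one_injective : Injective fun a : A => (Finsupp.single a 1 : H' A) := by
  cases subsingleton_or_nontrivial A
  · exact injective_of_subsingleton _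
  have : Nontrivial (ZMod (AddMonoid.exponent A)) := ZMod.nontrivial_iff.2 fun h =>
    not_subsingleton A (AddMonoid.exp_eq_one_iff.1 h)
  exact Finsupp.single_left_injective one_ne_zero

theorem x'_injective : Injective D.x' := by
  rintro ⟨a, c⟩ ⟨a', c'⟩ h
  have hfst := single_one_injective A (congrArg AsymmetricProduct.fst h)
  have hsnd := sub_left_injective (congrArg (fun p => p.snd.fst) h)
  exact Prod.ext hfst hsnd

theorem eq_one_of_g_symm_eq_refl {p : D.A₁} (hp : (D.g p).symm = Equiv.refl A) : p = 1 := by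
  obtain ⟨d, τ⟩ := p
  have hfix (a : A) : (τ : A ≃ₗ[ℤ] A) a + d + D.offset τ = a := congrArg (· a) hp
  have h_zero : d + D.offset τ = 0 := by simpa using hfix 0
  obtain rfl : τ = 1 := by
    ext a
    simpa [add_assoc, h_zero] using hfix a
  obtain rfl : d = 0 := by simpa [offset_one] using h_zero
  rfl

theorem α'_injective : Injective D.α' := by
  rw [injective_iff_map_eq_one]
  refine fun p hp => D.eq_one_of_g_symm_eq_refl (Equiv.ext fun a => single_one_injective A ?_)
  simpa [α'_eq] using congrArg (· (Finsupp.single a 1)) hp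

/-- The projection `(f, (a, τ)) ↦ (f, τ)` of `B'`, as an additive homomorphism. -/
def projHT : D.B' →+ H' A × Additive D.T where
  toFun p := (p.fst, Additive.ofMul p.snd.snd)
  map_zero' := rfl
  map_add' p q := Prod.ext rfl (mul_one (p.snd.snd * q.snd.snd))

theorem ker_projHT_le : D.projHT.ker ≤ AddSubgroup.closure D.X' := by
  rintro ⟨f, d, τ⟩ hp
  obtain ⟨rfl, rfl⟩ : f = 0 ∧ τ = 1 := Prod.ext_iff.1 hp
  have hsub : (⟨0, d, 1⟩ : D.B') = D.x' (0, d) - D.x' 0 := by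
    rw [eq_sub_iff_add_eq]
    refine AsymmetricProduct.ext ?_ (SemidirectBrace.ext ?_ ?_) <;> simp [x', sub_eq_add_neg]
  rw [hsub]
  exact sub_mem (AddSubgroup.subset_closure ⟨_, rfl⟩) (AddSubgroup.subset_closure ⟨_, rfl⟩)

theorem map_projHT_closure_X' (ht : (orderOf D.t).Coprime (AddMonoid.exponent A)) :
    (AddSubgroup.closure D.X').map D.projHT = ⊤ := by
  let t : D.T := ⟨D.t, Subgroup.mem_zpowers D.t⟩
  have hv : AddSubgroup.closure (Set.range fun a : A × A => (Finsupp.single a.1 1 : H' A)) = ⊤ := by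
    rw [← closure_range_single_one A (AddMonoid.exponent A)]
    exact congrArg _ (Prod.fst_surjective.range_comp fun a => (Finsupp.single a 1 : H' A))
  have ht_gen : AddSubgroup.zmultiples (Additive.ofMul t) = ⊤ := by
    refine (AddSubgroup.eq_top_iff' _).2 fun τ => ?_
    obtain ⟨z, hz⟩ := Subgroup.mem_zpowers_iff.1 (Additive.toMul τ).2
    exact ⟨z, Subtype.ext hz⟩
  have ht_cop : (addOrderOf (Additive.ofMul t)).Coprime (AddMonoid.exponent A) := by
    rw [addOrderOf_ofMul_eq_orderOf, ← Subgroup.orderOf_coe]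
    exact ht
  rw [AddMonoidHom.map_closure, X', ← Set.range_comp]
  exact closure_range_prodMk_eq_top (ZModModule.char_nsmul_eq_zero _) hv ht_gen ht_cop

theorem closure_X' (ht : (orderOf D.t).Coprime (AddMonoid.exponent A)) :
    AddSubgroup.closure D.X' = ⊤ := by
  rw [← AddSubgroup.comap_map_eq_self D.ker_projHT_le, D.map_projHT_closure_X' ht,
    AddSubgroup.comap_top]

end SolutionData

theorem theorem4p5 {A : Type*} [AddCommGroup A] (D : SolutionData A)
    (hn : 1 < AddMonoid.exponent A) (ht : (orderOf D.t).Coprime (AddMonoid.exponent A)) :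
    Nonempty (D.solution'.PermutationGroup ≃+* AsymmetricProduct D.datum.modRadical) ∧
    Nonempty (D.square.PermutationGroup ≃+* AsymmetricProduct D.datum.modRadical) := by
  have hgen : AddSubgroup.closure D.X' = ⊤ := D.closure_X' ht
  have hgen_val : AddSubgroup.closure (Set.range ((↑) : D.X' → D.B')) = ⊤ := by
    rwa [Subtype.range_coe]
  exact ⟨⟨AsymmetricProduct.permutationGroupEquiv D.α'_injective (fun _ _ => rfl)
      Subtype.val_injective hgen_val⟩,
    ⟨AsymmetricProduct.permutationGroupEquiv D.α'_injective D.lam_x' D.x'_injective hgen⟩⟩
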